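/- Let $M$ be a compact complex manifold of dimension $m$, let $L\to M$ be a holomorphic line bundle and let $h$ be a smooth Hermitian metric on $L$ whose Chern curvature $\Theta(h)$ is such that $\omega=i\,\Theta(h)$ is a Kähler form (so $L$ is ample and $M$ is projective). Put $dV_M=\omega^m/m!$. For $N\in\mathbb N$ let $V_N=H^0(M,L^N)$, a finite-dimensional space, with the Hermitian product $\langle s,t\rangle=\int_M h^{\otimes N}(s,t)\,dV_M$, linear in $s$, and let $d_N+1=\dim V_N$. Let $\Pi_N:L^2(M,L^N)\to V_N$ be the orthogonal projector. For a smooth function $f:M\to\mathbb R$ let $T_{f,N}:V_N\to V_N$, $T_{f,N}s=\Pi_N(fs)$, be the Toeplitz operator and let $T^0_{f,N}=T_{f,N}-\frac{\operatorname{tr}T_{f,N}}{d_N+1}\operatorname{id}$; then $iT^0_{f,N}\in\mathfrak{su}(V_N)$. Let $\Phi_N:\mathbb P(V_N^*)\to\mathfrak{su}(V_N)$ be the moment map $$\Phi_N([\lambda])=i\Bigl(\frac{\langle\,\cdot\,,w\rangle w}{|w|^2}-\frac{\operatorname{id}}{d_N+1}\Bigr),\qquad \lambda=\langle\,\cdot\,,w\rangle,$$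 and let $(A,B)=-\operatorname{tr}(AB)$ on $\mathfrak{su}(V_N)$. For a point $z\in M$ that is not a base point of $L^N$ (some $s\in V_N$ has $s(z)\neq0$) let $\phi_N(z)=[s\mapsto s(z)]\in\mathbb P(V_N^*)$, where the fibre of $L^N$ at $z$ is identified with $\mathbb C$, and put $$P^0_Nf(z)=\bigl(\Phi_N(\phi_N(z)),\,iT^0_{f,N}\bigr).$$ Let $X\subset L^*$ be the unit circle bundle of the dual metric with projection $\pi:X\to M$. For a section $s$ of $L^N$ and $x\in X$ write $\hat s(x)=x^{\otimes N}(s(\pi(x)))$. Let $e_{x,N}\in V_N$ be the coherent state, defined by $\hat s(x)=\langle s,e_{x,N}\rangle$ for all $s\in V_N$, and let $\Pi_N(x,x')=\hat e_{x',N}(x)$, which is the integral kernel of $\Pi_N$. Set $K_N(z,z')=|\Pi_N(x,x')|^2$ and $E_N(z)=\Pi_N(x,x)$ for $\pi(x)=z$, $\pi(x')=z'$; these do not depend on the choice of $x,x'$. Then, for every $N\in\mathbb N$ and every smooth $f:M\to\mathbb R$: 1. if $z\in M$ is not a base point of $L^N$, then $E_N(z)>0$ and $$P^0_Nf(z)=\int_M\frac{K_N(z,z')}{E_N(z)}\,f(z')\,dV_M(z')-\frac{\operatorname{tr}T_{f,N}}{d_N+1};$$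 2. $$\operatorname{tr}T_{f,N}=\int_M E_N(z)\,f(z)\,dV_M(z).$$ -/

import Mathlib

open Bundle MeasureTheory Set
open scoped LinearAlgebra.Projectivization Manifold ContDiff TensorProduct ComplexConjugate

set_option linter.unusedSectionVars false

noncomputable section

namespace Toeplitz

/-! ### Linear algebra of a complex line -/

section Line

variable {V : Type*} [AddCommGroup V] [Module ℂ V]

/-- The `N`-th tensor power of a covector, `ξ^{⊗N}(v₁ ⊗ ⋯ ⊗ v_N) = ξ(v₁) ⋯ ξ(v_N)`. -/
def tpow (N : ℕ) (ξ : V →ₗ[ℂ] ℂ) : (⨂[ℂ]^N V) →ₗ[ℂ] ℂ :=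
  PiTensorProduct.lift ((MultilinearMap.mkPiAlgebra ℂ (Fin N) ℂ).compLinearMap fun _ => ξ)

theorem tpow_tprod (N : ℕ) (ξ : V →ₗ[ℂ] ℂ) (v : Fin N → V) :
    tpow N ξ (PiTensorProduct.tprod ℂ v) = ∏ i, ξ (v i) := by
  simp [tpow]

theorem tpow_smul (N : ℕ) (c : ℂ) (ξ : V →ₗ[ℂ] ℂ) : tpow N (c • ξ) = c ^ N • tpow N ξ := by
  apply PiTensorProduct.ext
  ext v
  simp [tpow_tprod, Finset.prod_mul_distrib]

theorem eq_tpow_smul (N : ℕ) {ξ : V →ₗ[ℂ] ℂ} (hξ : Function.Injective ξ) {l : V} (hl : ξ l = 1)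
    (u : ⨂[ℂ]^N V) : u = tpow N ξ u • PiTensorProduct.tprod ℂ (fun _ => l) := by
  have : (LinearMap.id : (⨂[ℂ]^N V) →ₗ[ℂ] (⨂[ℂ]^N V)) =
      (tpow N ξ).smulRight (PiTensorProduct.tprod ℂ (fun _ => l)) := by
    apply PiTensorProduct.ext
    ext v
    have hv : v = fun i => ξ (v i) • l := by
      funext i
      apply hξ
      simp [hl]
    simp only [LinearMap.compMultilinearMap_apply, LinearMap.id_apply, LinearMap.smulRight_apply,
      tpow_tprod]
    conv_lhs => rw [hv]
    rw [MultilinearMap.map_smul_univ]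
  exact LinearMap.congr_fun this u

end Line

/-! ### The moment map of a projective space -/

section MomentMap

variable (W : Type*) [NormedAddCommGroup W] [InnerProductSpace ℂ W]

/-- The Lie algebra `su(W)` of trace-free skew-Hermitian endomorphisms. -/
def su : Submodule ℝ (W →ₗ[ℂ] W) where
  carrier := {A | (∀ u v, inner ℂ (A u) v = -inner ℂ u (A v)) ∧ LinearMap.trace ℂ W A = 0}
  add_mem' := by
    rintro A B ⟨hA, hA'⟩ ⟨hB, hB'⟩
    refine ⟨fun u v => ?_, by rw [map_add, hA', hB', add_zero]⟩
    simp only [LinearMap.add_apply, inner_add_left, inner_add_right, hA, hB]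
    ring
  zero_mem' := by simp
  smul_mem' := by
    rintro c A ⟨hA, hA'⟩
    have hc : c • A = (c : ℂ) • A := rfl
    refine ⟨fun u v => ?_, by rw [hc, map_smul, hA', smul_zero]⟩
    rw [hc]
    simp only [LinearMap.smul_apply, inner_smul_left, inner_smul_right, hA, Complex.conj_ofReal]
    ring

variable {W}

/-- The product `(X, Y) = -tr(XY)` on `su(W)`. -/
def killing (X Y : su W) : ℂ := -LinearMap.trace ℂ W (X.1 ∘ₗ Y.1)

variable [FiniteDimensional ℂ W]

/-- The vector `w` such that `ξ = ⟨·, w⟩`. -/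
def riesz (ξ : Module.Dual ℂ W) : W :=
  haveI := FiniteDimensional.complete ℂ W
  (InnerProductSpace.toDual ℂ W).symm (LinearMap.toContinuousLinearMap ξ)

theorem inner_riesz (ξ : Module.Dual ℂ W) (v : W) : inner ℂ (riesz ξ) v = ξ v := by
  have := FiniteDimensional.complete ℂ W
  simp [riesz]

theorem riesz_ne_zero {ξ : Module.Dual ℂ W} (hξ : ξ ≠ 0) : riesz ξ ≠ 0 := by
  intro h0
  apply hξ
  ext v
  rw [← inner_riesz, h0, inner_zero_left, LinearMap.zero_apply]

/-- `i (⟨·, w⟩ w / |w|² - id / dim W)`. -/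
def momentEnd (w : W) : W →ₗ[ℂ] W :=
  Complex.I • (((‖w‖ ^ 2 : ℝ) : ℂ)⁻¹ • (innerₛₗ ℂ w).smulRight w -
    (Module.finrank ℂ W : ℂ)⁻¹ • LinearMap.id)

theorem momentEnd_mem {w : W} (hw : w ≠ 0) : momentEnd w ∈ su W := by
  refine ⟨fun u v => ?_, ?_⟩
  · simp only [momentEnd, LinearMap.smul_apply, LinearMap.sub_apply, LinearMap.smulRight_apply,
      innerₛₗ_apply_apply, LinearMap.id_apply, inner_smul_left, inner_smul_right, inner_sub_left,
      inner_sub_right, map_inv₀, Complex.conj_ofReal, Complex.conj_I, inner_conj_symm,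
      Complex.conj_natCast]
    ring
  · have h1 : (LinearMap.trace ℂ W) ((innerₛₗ ℂ w).smulRight w) = ((‖w‖ ^ 2 : ℝ) : ℂ) := by
      rw [LinearMap.trace_smulRight, innerₛₗ_apply_apply, inner_self_eq_norm_sq_to_K]
      simp
    have hn : ((‖w‖ ^ 2 : ℝ) : ℂ) ≠ 0 := by simpa using hw
    have : Nontrivial W := nontrivial_of_ne w 0 hw
    have hd : (Module.finrank ℂ W : ℂ) ≠ 0 := by
      simpa using (Module.finrank_pos (R := ℂ) (M := W)).ne'
    rw [momentEnd, map_smul, map_sub, map_smul, map_smul, h1, LinearMap.trace_id]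
    simp only [smul_eq_mul]
    rw [inv_mul_cancel₀ hn, inv_mul_cancel₀ hd, sub_self, mul_zero]

/-- The moment map `Φ : ℙ(W^*) → su(W)`, `Φ([ξ]) = i (⟨·, w⟩ w / |w|² - id / dim W)` where
`ξ = ⟨·, w⟩`. -/
def momentMap (x : ℙ ℂ (Module.Dual ℂ W)) : su W :=
  ⟨momentEnd (riesz x.rep), momentEnd_mem (riesz_ne_zero x.rep_nonzero)⟩

/-- The value of the moment map does not depend on the representative `ξ` of `[ξ]`. -/
theorem momentMap_mk (ξ : Module.Dual ℂ W) (hξ : ξ ≠ 0) :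
    (momentMap (Projectivization.mk ℂ ξ hξ)).1 = momentEnd (riesz ξ) := by
  obtain ⟨a, ha⟩ := Projectivization.exists_smul_eq_mk_rep ℂ ξ hξ
  have hr : riesz (Projectivization.mk ℂ ξ hξ).rep = conj (a : ℂ) • riesz ξ := by
    apply ext_inner_right ℂ
    intro v
    rw [inner_riesz, ← ha, inner_smul_left, inner_riesz, Complex.conj_conj]
    rfl
  have ha0 : ((‖(a : ℂ)‖ : ℝ) : ℂ) ≠ 0 := by simp
  have haa : (a : ℂ) * conj (a : ℂ) = ((‖(a : ℂ)‖ : ℝ) : ℂ) ^ 2 := Complex.mul_conj' _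
  simp only [momentMap, hr, momentEnd]
  congr 2
  ext v
  simp only [LinearMap.smul_apply, LinearMap.smulRight_apply, innerₛₗ_apply_apply, inner_smul_left,
    norm_smul, Complex.conj_conj, smul_smul, RCLike.norm_conj]
  congr 1
  push_cast
  rw [mul_pow, mul_inv]
  field_simp
  linear_combination (((‖riesz ξ‖ : ℝ) : ℂ)⁻¹ ^ 2 * inner ℂ (riesz ξ) v) * haa

end MomentMap

section Geometry

variable {m : ℕ} {M : Type*} [TopologicalSpace M] [ChartedSpace (Fin m → ℂ) M]
  {L : M → Type*} [TopologicalSpace (TotalSpace ℂ L)] [∀ z, AddCommGroup (L z)]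
  [∀ z, Module ℂ (L z)] [∀ z, TopologicalSpace (L z)] [FiberBundle ℂ L] [VectorBundle ℂ ℂ L]

/-- The `j`-th Wirtinger derivative `∂u/∂z_j = (∂u/∂x_j - i ∂u/∂y_j)/2`. -/
def dz (j : Fin m) (u : (Fin m → ℂ) → ℂ) (w : Fin m → ℂ) : ℂ :=
  (fderiv ℝ u w (Pi.single j 1) - Complex.I * fderiv ℝ u w (Pi.single j Complex.I)) / 2

/-- The `j`-th conjugate Wirtinger derivative `∂u/∂z̄_j = (∂u/∂x_j + i ∂u/∂y_j)/2`. -/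
def dzbar (j : Fin m) (u : (Fin m → ℂ) → ℂ) (w : Fin m → ℂ) : ℂ :=
  (fderiv ℝ u w (Pi.single j 1) + Complex.I * fderiv ℝ u w (Pi.single j Complex.I)) / 2

/-- A local trivialization of `L` over an open set. -/
abbrev Triv (L : M → Type*) [TopologicalSpace (TotalSpace ℂ L)] :=
  Trivialization ℂ (TotalSpace.proj : TotalSpace ℂ L → M)

/-- For a field `form` of sesquilinear forms on the fibres of `L`, the function
`|σ|² = form (σ, σ)` of the local frame `σ = e⁻¹(1)`, written in the chart `φ`. -/
def weight (form : ∀ z, L z →ₗ[ℂ] L z →ₗ⋆[ℂ] ℂ) (e : Triv L)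
    (φ : OpenPartialHomeomorph M (Fin m → ℂ)) (w : Fin m → ℂ) : ℝ :=
  (form (φ.symm w) (e.symm (φ.symm w) 1) (e.symm (φ.symm w) 1)).re

/-- The part of the chart `φ` that lies over the domain of the trivialization `e`. -/
def overlap (e : Triv L) (φ : OpenPartialHomeomorph M (Fin m → ℂ)) : Set (Fin m → ℂ) :=
  φ.target ∩ φ.symm ⁻¹' e.baseSet

theorem isOpen_overlap (e : Triv L) (φ : OpenPartialHomeomorph M (Fin m → ℂ)) :
    IsOpen (overlap e φ) :=
  φ.isOpen_inter_preimage_symm e.open_baseSet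

theorem frame_ne_zero (e : Triv L) [MemTrivializationAtlas e] {z : M} (hz : z ∈ e.baseSet) :
    e.symm z (1 : ℂ) ≠ 0 := by
  intro h0
  have := e.linearMapAt_symmₗ (R := ℂ) hz (1 : ℂ)
  rw [Trivialization.coe_symmₗ _ hz, h0, map_zero] at this
  exact zero_ne_one this

theorem exists_frame (z : M) : ∃ l : L z, l ≠ 0 :=
  ⟨_, frame_ne_zero (trivializationAt ℂ L z) (FiberBundle.mem_baseSet_trivializationAt' z)⟩

/-- The coefficients `g_{jk} = -∂²(log |σ|²)/∂z_j∂z̄_k` of the curvature: the curvature of the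
Chern connection is `Θ = ∂̄∂ log |σ|²`, so that `ω = iΘ = i ∑ g_{jk} dz_j ∧ dz̄_k`. -/
def curvature (form : ∀ z, L z →ₗ[ℂ] L z →ₗ⋆[ℂ] ℂ) (e : Triv L)
    (φ : OpenPartialHomeomorph M (Fin m → ℂ)) (w : Fin m → ℂ) : Matrix (Fin m) (Fin m) ℂ :=
  Matrix.of fun j k =>
    -dz j (dzbar k fun w' => (Real.log (weight form e φ w') : ℂ)) w

open scoped ComplexOrder in
variable (m L) in
/-- A smooth Hermitian metric on the holomorphic line bundle `L` such that `ω = iΘ` is a Kähler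
form (`ω` is closed of type `(1,1)`, so only its positivity is a condition).
The forms are linear in the first and conjugate linear in the second variable. -/
structure PositiveMetric where
  form : ∀ z, L z →ₗ[ℂ] L z →ₗ⋆[ℂ] ℂ
  conj_symm : ∀ z (u v : L z), conj (form z v u) = form z u v
  pos_def : ∀ z (v : L z), v ≠ 0 → 0 < (form z v v).re
  smooth : ∀ (e : Triv L) [MemTrivializationAtlas e], ∀ φ ∈ atlas (Fin m → ℂ) M,
    ContDiffOn ℝ ∞ (weight form e φ) (overlap e φ)
  curvature_pos : ∀ (e : Triv L) [MemTrivializationAtlas e], ∀ φ ∈ atlas (Fin m → ℂ) M,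
    ∀ w ∈ overlap e φ, (curvature form e φ w).PosDef

/-! ### The volume measure -/

section Volume

variable [CompactSpace M] [T2Space M]

variable (m L) in
/-- The domain on which both the preferred chart and the preferred frame at `p` are defined. -/
def patch (p : M) : Set M :=
  (chartAt (Fin m → ℂ) p).source ∩ (trivializationAt ℂ L p).baseSet

variable (m L) in
theorem isOpen_patch (p : M) : IsOpen (patch m L p) :=
  (chartAt (Fin m → ℂ) p).open_source.inter (trivializationAt ℂ L p).open_baseSet

variable (m L) in
theorem exists_partition :
    ∃ ρ : PartitionOfUnity M M univ, ρ.IsSubordinate (patch m L) :=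
  PartitionOfUnity.exists_isSubordinate isClosed_univ _ (isOpen_patch m L) fun p _ =>
    mem_iUnion.2 ⟨p, mem_chart_source _ p, FiberBundle.mem_baseSet_trivializationAt' p⟩

variable (m L) in
/-- A partition of unity subordinate to the patches. -/
def partition : PartitionOfUnity M M univ := (exists_partition m L).choose

variable [MeasurableSpace M] [BorelSpace M]

namespace PositiveMetric

variable (h : PositiveMetric m L)

/-- The density of `ω^m / m! = det(g) ∏ (i dz_j ∧ dz̄_j) = 2^m det(g) dx_1 dy_1 ⋯ dx_m dy_m` in the
preferred chart at `p`. -/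
def density (p : M) (w : Fin m → ℂ) : ℝ :=
  2 ^ m * (curvature h.form (trivializationAt ℂ L p) (chartAt (Fin m → ℂ) p) w).det.re

/-- The volume measure `dV = ω^m / m!` of `M`, glued from charts by a partition of unity. -/
def dV : Measure M :=
  Measure.sum fun p : M =>
    ((volume.restrict (chartAt (Fin m → ℂ) p).target).withDensity fun w =>
      ENNReal.ofReal (partition m L p ((chartAt (Fin m → ℂ) p).symm w) * h.density p w)).map
      (chartAt (Fin m → ℂ) p).symm


theorem weight_pos (e : Triv L) [MemTrivializationAtlas e]
    (φ : OpenPartialHomeomorph M (Fin m → ℂ)) {w : Fin m → ℂ} (hw : w ∈ overlap e φ) :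
    0 < weight h.form e φ w :=
  h.pos_def _ _ (frame_ne_zero e hw.2)

theorem contDiffOn_curvature (e : Triv L) [MemTrivializationAtlas e]
    {φ : OpenPartialHomeomorph M (Fin m → ℂ)} (hφ : φ ∈ atlas (Fin m → ℂ) M) (j k : Fin m) :
    ContDiffOn ℝ ∞ (fun w => curvature h.form e φ w j k) (overlap e φ) := by
  have hO := isOpen_overlap e φ
  have key : ∀ (u : (Fin m → ℂ) → ℂ), ContDiffOn ℝ ∞ u (overlap e φ) → ∀ v : Fin m → ℂ,
      ContDiffOn ℝ ∞ (fun w => fderiv ℝ u w v) (overlap e φ) := fun u hu v =>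
    (hu.fderiv_of_isOpen hO (by simp)).clm_apply contDiffOn_const
  have h1 : ContDiffOn ℝ ∞ (fun w' => (Real.log (weight h.form e φ w') : ℂ)) (overlap e φ) :=
    Complex.ofRealCLM.contDiff.comp_contDiffOn
      ((h.smooth e φ hφ).log fun w hw => (h.weight_pos e φ hw).ne')
  have h2 : ContDiffOn ℝ ∞ (dzbar k fun w' => (Real.log (weight h.form e φ w') : ℂ))
      (overlap e φ) :=
    ((key _ h1 _).add (contDiffOn_const.mul (key _ h1 _))).div_const 2
  exact (((key _ h2 _).sub (contDiffOn_const.mul (key _ h2 _))).div_const 2).neg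

theorem continuousOn_density (p : M) :
    ContinuousOn (h.density p) (overlap (trivializationAt ℂ L p) (chartAt (Fin m → ℂ) p)) := by
  refine continuousOn_const.mul (Complex.continuous_re.comp_continuousOn ?_)
  rw [continuousOn_iff_continuous_domRestrict]
  apply Continuous.matrix_det
  refine continuous_pi fun j => continuous_pi fun k => ?_
  exact continuousOn_iff_continuous_domRestrict.1
    (h.contDiffOn_curvature _ (chart_mem_atlas _ p) j k).continuousOn

open scoped ComplexOrder in
theorem density_pos (p : M) {w : Fin m → ℂ}
    (hw : w ∈ overlap (trivializationAt ℂ L p) (chartAt (Fin m → ℂ) p)) : 0 < h.density p w := by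
  have := (h.curvature_pos (trivializationAt ℂ L p) _ (chart_mem_atlas _ p) w hw).det_pos
  have h2 := (Complex.lt_def.1 this).1
  exact mul_pos (by positivity) (by simpa using h2)

theorem tsupport_subset (p : M) : tsupport (partition m L p) ⊆ patch m L p :=
  (exists_partition m L).choose_spec p

instance : IsFiniteMeasure h.dV := by
  have hfin : ∀ p : M, ∫⁻ w in (chartAt (Fin m → ℂ) p).target,
      ENNReal.ofReal (partition m L p ((chartAt (Fin m → ℂ) p).symm w) * h.density p w) < ⊤ := by
    intro p
    set φ := chartAt (Fin m → ℂ) p with hφ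
    have hsub : tsupport (partition m L p) ⊆ φ.source := fun x hx => (tsupport_subset p hx).1
    have hK : IsCompact (φ '' tsupport (partition m L p)) :=
      (isClosed_tsupport _).isCompact.image_of_continuousOn (φ.continuousOn.mono hsub)
    have hKo : φ '' tsupport (partition m L p) ⊆ overlap (trivializationAt ℂ L p) φ := by
      rintro _ ⟨x, hx, rfl⟩
      refine ⟨φ.map_source (hsub hx), ?_⟩
      simpa [φ.left_inv (hsub hx)] using (tsupport_subset p hx).2
    obtain ⟨C, hC⟩ := hK.exists_bound_of_continuousOn ((h.continuousOn_density p).mono hKo)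
    calc ∫⁻ w in φ.target, ENNReal.ofReal (partition m L p (φ.symm w) * h.density p w)
        ≤ ∫⁻ w in φ.target, (φ '' tsupport (partition m L p)).indicator
            (fun _ => ENNReal.ofReal C) w := by
          refine setLIntegral_mono' φ.open_target.measurableSet fun w hw => ?_
          by_cases hw' : φ.symm w ∈ tsupport (partition m L p)
          · have hwK : w ∈ φ '' tsupport (partition m L p) := ⟨_, hw', φ.right_inv hw⟩
            rw [indicator_of_mem hwK]
            apply ENNReal.ofReal_le_ofReal
            have h1 := (h.density_pos p (hKo hwK)).le
            have h2 := hC w hwK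
            rw [Real.norm_of_nonneg h1] at h2
            have h3 := (partition m L).le_one p (φ.symm w)
            calc _ ≤ 1 * h.density p w := by gcongr
              _ ≤ C := by rwa [one_mul]
          · rw [image_eq_zero_of_notMem_tsupport hw']
            simp
      _ ≤ ∫⁻ w, (φ '' tsupport (partition m L p)).indicator (fun _ => ENNReal.ofReal C) w :=
          setLIntegral_le_lintegral _ _
      _ = ENNReal.ofReal C * volume (φ '' tsupport (partition m L p)) := by
          rw [lintegral_indicator hK.measurableSet, setLIntegral_const]
      _ < ⊤ := ENNReal.mul_lt_top ENNReal.ofReal_lt_top hK.measure_lt_top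
  have hS : {p : M | (Function.support (partition m L p)).Nonempty}.Finite :=
    (partition m L).locallyFinite.finite_nonempty_of_compact
  constructor
  rw [dV, Measure.sum_apply _ MeasurableSet.univ, tsum_eq_sum (s := hS.toFinset)]
  · refine ENNReal.sum_lt_top.2 fun p _ => ?_
    have := isFiniteMeasure_withDensity (hfin p).ne
    exact measure_lt_top _ _
  · intro p hp
    have h0 : ∀ x, partition m L p x = 0 := by
      intro x
      by_contra hx
      exact hp (hS.mem_toFinset.2 ⟨x, hx⟩)
    simp [h0]

instance : h.dV.IsOpenPosMeasure := by
  constructor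
  rintro U hU ⟨x, hx⟩ h0
  obtain ⟨p, hp⟩ := (partition m L).exists_pos (mem_univ x)
  set φ := chartAt (Fin m → ℂ) p with hφ
  have hxs : x ∈ φ.source := (tsupport_subset p (subset_tsupport _ hp.ne')).1
  set W : Set M := U ∩ {y | 0 < partition m L p y} with hW
  have hWo : IsOpen W := hU.inter (isOpen_lt continuous_const (partition m L p).continuous)
  set O : Set (Fin m → ℂ) := φ.target ∩ φ.symm ⁻¹' W with hO
  have hOo : IsOpen O := φ.isOpen_inter_preimage_symm hWo
  have hxO : φ x ∈ O := ⟨φ.map_source hxs, by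
    rw [mem_preimage, φ.left_inv hxs]; exact ⟨hx, hp⟩⟩
  have hOov : O ⊆ overlap (trivializationAt ℂ L p) φ := fun w hw =>
    ⟨hw.1, (tsupport_subset p (subset_tsupport _ hw.2.2.ne')).2⟩
  set d : (Fin m → ℂ) → ENNReal := fun w =>
    ENNReal.ofReal (partition m L p (φ.symm w) * h.density p w) with hd
  have hdc : ContinuousOn d O := ENNReal.continuous_ofReal.comp_continuousOn
    (((partition m L p).continuous.comp_continuousOn (φ.continuousOn_symm.mono inter_subset_left)).mul
      ((h.continuousOn_density p).mono hOov))
  have hsymm : AEMeasurable φ.symm ((volume.restrict φ.target).withDensity d) :=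
    (φ.continuousOn_symm.aemeasurable φ.open_target.measurableSet).mono_ac
      (withDensity_absolutelyContinuous _ _)
  have h1 : ((volume.restrict φ.target).withDensity d).map φ.symm U = 0 := by
    rw [dV, Measure.sum_apply _ hU.measurableSet, ENNReal.tsum_eq_zero] at h0
    exact h0 p
  rw [Measure.map_apply_of_aemeasurable hsymm hU.measurableSet] at h1
  have h2 : (volume.restrict φ.target).withDensity d O = 0 :=
    measure_mono_null (fun w hw => hw.2.1) h1
  rw [withDensity_apply _ hOo.measurableSet, Measure.restrict_restrict hOo.measurableSet,
    inter_eq_self_of_subset_left (fun w hw => hw.1 : O ⊆ φ.target),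
    setLIntegral_eq_zero_iff' hOo.measurableSet (hdc.aemeasurable hOo.measurableSet)] at h2
  have h3 : volume O = 0 := by
    refine measure_mono_null (fun w hw => ?_) (ae_iff.1 h2)
    have : 0 < d w := ENNReal.ofReal_pos.2 (mul_pos hw.2.2 (h.density_pos p (hOov hw)))
    simp only [mem_ofPred_eq, Classical.not_imp]
    exact ⟨hw, this.ne'⟩
  exact hOo.measure_ne_zero volume ⟨_, hxO⟩ h3


/-! ### The metric on `L^N` and the unit circle bundle -/

/-- A covector of dual norm one: as the fibre is a line, this means `|ξ(v)| = |v|` for all `v`. -/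
def IsUnitCovector {z : M} (ξ : L z →ₗ[ℂ] ℂ) : Prop :=
  ∀ v : L z, ‖ξ v‖ ^ 2 = (h.form z v v).re

/-- The unit covector at `z` that is a positive multiple of the preferred trivialization. -/
def unitCovector (z : M) : L z →ₗ[ℂ] ℂ :=
  ((Real.sqrt (h.form z ((trivializationAt ℂ L z).symm z 1)
    ((trivializationAt ℂ L z).symm z 1)).re : ℝ) : ℂ) •
      (trivializationAt ℂ L z).linearMapAt ℂ z

theorem smul_isUnitCovector (e : Triv L) [MemTrivializationAtlas e] {z : M} (hz : z ∈ e.baseSet) :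
    h.IsUnitCovector (((Real.sqrt (h.form z (e.symm z 1) (e.symm z 1)).re : ℝ) : ℂ) •
      e.linearMapAt ℂ z) := by
  intro v
  set l := e.symm z (1 : ℂ) with hl
  have hv : v = e.linearMapAt ℂ z v • l := by
    have h1 := e.symmₗ_linearMapAt (R := ℂ) hz v
    have h2 : e.symmₗ ℂ z (e.linearMapAt ℂ z v • (1 : ℂ)) = e.linearMapAt ℂ z v • l := by
      rw [map_smul, Trivialization.coe_symmₗ _ hz]
    rw [smul_eq_mul, mul_one, h1] at h2
    exact h2
  set c := e.linearMapAt ℂ z v with hc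
  have hpos := (h.pos_def z l (frame_ne_zero e hz)).le
  have him : (h.form z l l).im = 0 := Complex.conj_eq_iff_im.1 (h.conj_symm z l l)
  rw [LinearMap.smul_apply, ← hc, smul_eq_mul, norm_mul, mul_pow, Complex.norm_real,
    Real.norm_of_nonneg (Real.sqrt_nonneg _), Real.sq_sqrt hpos, ← Complex.normSq_eq_norm_sq]
  have hcl : h.form z (c • l) (c • l) = c * (conj c * h.form z l l) := by
    rw [LinearMap.map_smulₛₗ (h.form z (c • l)), LinearMap.map_smul (h.form z)]
    simp only [LinearMap.smul_apply, smul_eq_mul]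
    ring
  rw [hv, hcl]
  simp [him, Complex.normSq_apply]
  ring

theorem unitCovector_isUnit (z : M) : h.IsUnitCovector (h.unitCovector z) :=
  h.smul_isUnitCovector (trivializationAt ℂ L z) (FiberBundle.mem_baseSet_trivializationAt' z)

/-- The Hermitian product `h^{⊗N}` on the fibre of `L^N` at `z`. -/
def tensorForm (N : ℕ) (z : M) (u v : ⨂[ℂ]^N (L z)) : ℂ :=
  tpow N (h.unitCovector z) u * conj (tpow N (h.unitCovector z) v)

variable {h} in
theorem IsUnitCovector.injective {z : M} {ξ : L z →ₗ[ℂ] ℂ} (hξ : h.IsUnitCovector ξ) :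
    Function.Injective ξ := by
  rw [injective_iff_map_eq_zero]
  intro v hv
  by_contra hne
  have h1 := h.pos_def z v hne
  rw [← hξ v, hv] at h1
  simp at h1

variable {h} in
theorem IsUnitCovector.exists_eq_one {z : M} {ξ : L z →ₗ[ℂ] ℂ} (hξ : h.IsUnitCovector ξ) :
    ∃ l, ξ l = 1 := by
  obtain ⟨l, hl⟩ := exists_frame (L := L) z
  have : ξ l ≠ 0 := fun h0 => hl (hξ.injective (by rw [h0, map_zero]))
  exact ⟨(ξ l)⁻¹ • l, by simp [this]⟩

/-- Two unit covectors at a point differ by a phase. -/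
theorem exists_phase {z : M} {ξ η : L z →ₗ[ℂ] ℂ} (hξ : h.IsUnitCovector ξ)
    (hη : h.IsUnitCovector η) : ∃ c : ℂ, ‖c‖ = 1 ∧ η = c • ξ := by
  obtain ⟨l, hl⟩ := hξ.exists_eq_one
  refine ⟨η l, ?_, ?_⟩
  · have h1 := hη l
    rw [← hξ l, hl] at h1
    have h2 : ‖η l‖ ^ 2 = 1 ^ 2 := by simpa using h1
    exact (pow_left_inj₀ (norm_nonneg _) zero_le_one two_ne_zero).1 h2
  · ext v
    have hv : v = ξ v • l := hξ.injective (by simp [hl])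
    conv_lhs => rw [hv]
    simp [mul_comm]

/-- `h^{⊗N}(u, v) = ξ^{⊗N}(u) conj(ξ^{⊗N}(v))` for every unit covector `ξ`. -/
theorem tensorForm_eq (N : ℕ) {z : M} {ξ : L z →ₗ[ℂ] ℂ} (hξ : h.IsUnitCovector ξ)
    (u v : ⨂[ℂ]^N (L z)) : h.tensorForm N z u v = tpow N ξ u * conj (tpow N ξ v) := by
  obtain ⟨c, hc, rfl⟩ := h.exists_phase (h.unitCovector_isUnit z) hξ
  have hcc : c ^ N * conj (c ^ N) = 1 := by
    rw [Complex.mul_conj, Complex.normSq_eq_norm_sq, norm_pow, hc]; simp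
  rw [tpow_smul, tensorForm]
  simp only [LinearMap.smul_apply, smul_eq_mul, map_mul]
  linear_combination (-(tpow N (h.unitCovector z) u * conj (tpow N (h.unitCovector z) v))) * hcc

/-- `h^{⊗N}(u₁ ⊗ ⋯ ⊗ u_N, v₁ ⊗ ⋯ ⊗ v_N) = ∏ h(u_i, v_i)`. -/
theorem tensorForm_tprod (N : ℕ) (z : M) (u v : Fin N → L z) :
    h.tensorForm N z (PiTensorProduct.tprod ℂ u) (PiTensorProduct.tprod ℂ v) =
      ∏ i, h.form z (u i) (v i) := by
  have hξ := h.unitCovector_isUnit z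
  set ξ := h.unitCovector z with hξd
  obtain ⟨l, hl⟩ := hξ.exists_eq_one
  have hll : h.form z l l = 1 := by
    apply Complex.ext
    · simpa [hl] using (hξ l).symm
    · simpa using Complex.conj_eq_iff_im.1 (h.conj_symm z l l)
  have hrep : ∀ w : L z, w = ξ w • l := fun w => hξ.injective (by simp [hl])
  have key : ∀ a b : L z, h.form z a b = ξ a * conj (ξ b) := by
    intro a b
    conv_lhs => rw [hrep a, hrep b]
    rw [LinearMap.map_smulₛₗ (h.form z (ξ a • l)), LinearMap.map_smul (h.form z)]
    simp only [LinearMap.smul_apply, smul_eq_mul, hll]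
    ring
  rw [tensorForm_eq h N hξ, tpow_tprod, tpow_tprod, map_prod, ← Finset.prod_mul_distrib]
  exact Finset.prod_congr rfl fun i _ => (key _ _).symm

/-! ### Sections of `L^N` -/

variable (L) in
/-- The coordinate of a section of `L^N` in the frame of `L^N` induced by a trivialization of `L`. -/
def coord (N : ℕ) (e : Triv L) [MemTrivializationAtlas e] (s : ∀ z, ⨂[ℂ]^N (L z)) (z : M) : ℂ :=
  tpow N (e.linearMapAt ℂ z) (s z)

variable (L) in
/-- The continuous sections of `L^N`. -/
def continuousSections (N : ℕ) : Submodule ℂ (∀ z, ⨂[ℂ]^N (L z)) where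
  carrier := {s | ∀ (e : Triv L) [MemTrivializationAtlas e], ContinuousOn (coord L N e s) e.baseSet}
  add_mem' := fun {s t} hs ht e _ =>
    ((hs e).add (ht e)).congr fun z _ => by simp [coord]
  zero_mem' := fun e _ => continuousOn_const.congr fun z _ => by
    simp only [coord, Pi.zero_apply, map_zero]; rfl
  smul_mem' := fun c s hs e _ =>
    (continuousOn_const.mul (hs e)).congr (f := fun z => c * coord L N e s z) fun z _ => by
      simp [coord]

variable {h} {N : ℕ}

theorem continuousOn_weight (h : PositiveMetric m L) (e : Triv L) [MemTrivializationAtlas e] :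
    ContinuousOn (fun z => (h.form z (e.symm z 1) (e.symm z 1)).re) e.baseSet := by
  intro z hz
  set φ := chartAt (Fin m → ℂ) z with hφ
  have hzs : z ∈ φ.source := mem_chart_source _ z
  have hov : φ z ∈ overlap e φ := ⟨φ.map_source hzs, by simpa [φ.left_inv hzs] using hz⟩
  have h1 : ContinuousAt (weight h.form e φ) (φ z) :=
    (h.smooth e φ (chart_mem_atlas _ z)).continuousOn.continuousAt
      ((isOpen_overlap e φ).mem_nhds hov)
  have h2 : ContinuousAt (weight h.form e φ ∘ φ) z := h1.comp (φ.continuousAt hzs)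
  refine (h2.congr ?_).continuousWithinAt
  filter_upwards [φ.open_source.mem_nhds hzs] with y hy
  show (h.form (φ.symm (φ y)) (e.symm (φ.symm (φ y)) 1) (e.symm (φ.symm (φ y)) 1)).re = _
  rw [φ.left_inv hy]

theorem continuous_tensorForm (h : PositiveMetric m L) (s t : continuousSections L N) :
    Continuous fun z => h.tensorForm N z (s.1 z) (t.1 z) := by
  rw [continuous_iff_continuousAt]
  intro z
  set e := trivializationAt ℂ L z with he
  have hz : z ∈ e.baseSet := FiberBundle.mem_baseSet_trivializationAt' z
  have hc : ContinuousOn (fun y => (((Real.sqrt (h.form y (e.symm y 1) (e.symm y 1)).re : ℝ) : ℂ) ^ N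
      * coord L N e s.1 y) * conj (((Real.sqrt (h.form y (e.symm y 1) (e.symm y 1)).re : ℝ) : ℂ) ^ N
      * coord L N e t.1 y)) e.baseSet := by
    have hw : ContinuousOn (fun y => ((Real.sqrt (h.form y (e.symm y 1) (e.symm y 1)).re : ℝ) : ℂ) ^ N)
        e.baseSet :=
      (Complex.continuous_ofReal.comp_continuousOn (continuousOn_weight h e).sqrt).pow N
    exact (hw.mul (s.2 e)).mul
      (Complex.continuous_conj.comp_continuousOn (hw.mul (t.2 e)))
  refine (hc.continuousAt (e.open_baseSet.mem_nhds hz)).congr ?_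
  filter_upwards [e.open_baseSet.mem_nhds hz] with y hy
  rw [h.tensorForm_eq N (h.smul_isUnitCovector e hy), tpow_smul]
  rfl

theorem integrable_tensorForm (h : PositiveMetric m L) (s t : continuousSections L N) :
    Integrable (fun z => h.tensorForm N z (s.1 z) (t.1 z)) h.dV :=
  (continuous_tensorForm h s t).integrable_of_hasCompactSupport
    (HasCompactSupport.of_compactSpace _)

theorem tensorForm_self (z : M) (u : ⨂[ℂ]^N (L z)) :
    h.tensorForm N z u u = ((‖tpow N (h.unitCovector z) u‖ ^ 2 : ℝ) : ℂ) := by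
  rw [tensorForm, Complex.mul_conj, Complex.normSq_eq_norm_sq]

theorem tpow_eq_zero_iff {z : M} {ξ : L z →ₗ[ℂ] ℂ} (hξ : h.IsUnitCovector ξ) (u : ⨂[ℂ]^N (L z)) :
    tpow N ξ u = 0 ↔ u = 0 := by
  refine ⟨fun h0 => ?_, fun h0 => by rw [h0, map_zero]⟩
  obtain ⟨l, hl⟩ := hξ.exists_eq_one
  rw [eq_tpow_smul N hξ.injective hl u, h0, zero_smul]

variable (h N) in
/-- The `L²` Hermitian product `⟨s, t⟩ = ∫ h^{⊗N}(s, t) dV`, linear in `s`.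
Mathlib's `inner` is linear in its second argument, so `inner t s = ⟨s, t⟩`. -/
abbrev l2Core : InnerProductSpace.Core ℂ (continuousSections L N) where
  inner t s := ∫ z, h.tensorForm N z (s.1 z) (t.1 z) ∂h.dV
  conj_inner_symm s t := by
    rw [← integral_conj]
    congr 1
    funext z
    simp [tensorForm, mul_comm]
  re_inner_nonneg s := by
    have : (∫ z, h.tensorForm N z (s.1 z) (s.1 z) ∂h.dV) =
        ((∫ z, ‖tpow N (h.unitCovector z) (s.1 z)‖ ^ 2 ∂h.dV : ℝ) : ℂ) := by
      rw [← integral_complex_ofReal]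
      exact integral_congr_ae (Filter.Eventually.of_forall fun z => tensorForm_self z _)
    rw [this]
    exact integral_nonneg fun z => by positivity
  add_left s t u := by
    rw [← integral_add (integrable_tensorForm h _ _) (integrable_tensorForm h _ _)]
    congr 1
    funext z
    simp [tensorForm, mul_add]
  smul_left s t r := by
    rw [← integral_const_mul]
    congr 1
    funext z
    simp [tensorForm]
    ring
  definite s hs := by
    have hcont : Continuous fun z => ‖tpow N (h.unitCovector z) (s.1 z)‖ ^ 2 := by
      refine (Complex.continuous_re.comp (continuous_tensorForm h s s)).congr fun z => ?_
      simp only [Function.comp, tensorForm_self, Complex.ofReal_re]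
    have h1 : (∫ z, ‖tpow N (h.unitCovector z) (s.1 z)‖ ^ 2 ∂h.dV) = 0 := by
      have h2 : (∫ z, h.tensorForm N z (s.1 z) (s.1 z) ∂h.dV) =
          ((∫ z, ‖tpow N (h.unitCovector z) (s.1 z)‖ ^ 2 ∂h.dV : ℝ) : ℂ) := by
        rw [← integral_complex_ofReal]
        exact integral_congr_ae (Filter.Eventually.of_forall fun z => tensorForm_self z _)
      rw [← Complex.ofReal_eq_zero, ← h2]
      exact hs
    apply Subtype.ext
    funext z
    have h4 : ‖tpow N (h.unitCovector z) (s.1 z)‖ ^ 2 = 0 := by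
      by_contra hne
      exact (integral_pos_of_integrable_nonneg_nonzero (μ := h.dV) hcont
        (hcont.integrable_of_hasCompactSupport (HasCompactSupport.of_compactSpace _))
        (fun z => by positivity) hne).ne' h1
    have h5 := (tpow_eq_zero_iff (h.unitCovector_isUnit z) _).1
      (norm_eq_zero.1 (pow_eq_zero_iff two_ne_zero |>.1 h4))
    exact h5

/-- The space `C(M, L^N)` of continuous sections of `L^N` with the `L²` product. -/
def Sec (_h : PositiveMetric m L) (N : ℕ) : Type _ := continuousSections L N

instance : NormedAddCommGroup (h.Sec N) := (l2Core h N).toNormedAddCommGroup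

instance : InnerProductSpace ℂ (h.Sec N) := InnerProductSpace.ofCore (l2Core h N).toCore

instance : Inner ℂ (h.Sec N) := InnerProductSpace.toInner

/-- The underlying section. -/
def Sec.val (s : h.Sec N) (z : M) : ⨂[ℂ]^N (L z) := Subtype.val (p := (· ∈ continuousSections L N)) s z

theorem Sec.continuousOn (s : h.Sec N) (e : Triv L) [MemTrivializationAtlas e] :
    ContinuousOn (coord L N e s.val) e.baseSet := Subtype.property s e

theorem Sec.ext {s t : h.Sec N} (hst : ∀ z, s.val z = t.val z) : s = t :=
  Subtype.ext (funext hst)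

theorem Sec.val_add (s t : h.Sec N) (z : M) : (s + t).val z = s.val z + t.val z := rfl

theorem Sec.val_smul (c : ℂ) (s : h.Sec N) (z : M) : (c • s).val z = c • s.val z := rfl

/-- The product of a continuous function and a continuous section. -/
def Sec.mulFun (f : C(M, ℝ)) (s : h.Sec N) : h.Sec N :=
  ⟨fun z => (f z : ℂ) • s.val z, fun e _ =>
    ((Complex.continuous_ofReal.comp f.continuous).continuousOn.mul (s.continuousOn e)).congr
      (f := fun z => (f z : ℂ) * coord L N e s.val z) fun z _ => by simp [coord]⟩

theorem Sec.val_mulFun (f : C(M, ℝ)) (s : h.Sec N) (z : M) :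
    (s.mulFun f).val z = (f z : ℂ) • s.val z := rfl

theorem inner_def (s t : h.Sec N) :
    inner ℂ t s = ∫ z, h.tensorForm N z (s.val z) (t.val z) ∂h.dV := rfl

variable (h N) in
/-- The space `V_N = H⁰(M, L^N)` of holomorphic sections of `L^N`. -/
def H0 : Submodule ℂ (h.Sec N) where
  carrier := {s | ∀ (e : Triv L) [MemTrivializationAtlas e],
    MDifferentiableOn 𝓘(ℂ, Fin m → ℂ) 𝓘(ℂ, ℂ) (coord L N e s.val) e.baseSet}
  add_mem' := fun {s t} hs ht e _ =>
    ((hs e).add (ht e)).congr fun z _ => by simp [coord, Sec.val_add]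
  zero_mem' := fun e _ => mdifferentiableOn_const.congr (f := fun _ => (0 : ℂ)) fun z _ => by
    show tpow N _ 0 = 0
    rw [map_zero]
  smul_mem' := fun c s hs e _ =>
    ((hs e).const_smul c).congr fun z _ => by simp [coord, Sec.val_smul]

variable (h N) in
/-- The Hilbert space `L²(M, L^N)`, the completion of the continuous sections for the
`L²` product. -/
abbrev L2 : Type _ := UniformSpace.Completion (h.Sec N)

instance : Inner ℂ (h.L2 N) := InnerProductSpace.toInner

variable (h N) in
/-- The inclusion of `V_N` in `L²(M, L^N)`. -/
def inclL2 : h.H0 N →ₗᵢ[ℂ] h.L2 N :=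
  UniformSpace.Completion.toComplₗᵢ.comp (h.H0 N).subtypeₗᵢ

variable (h N) in
/-- The orthogonal projector `Π_N` of `L²(M, L^N)` onto `V_N`. -/
def proj [FiniteDimensional ℂ (h.H0 N)] : h.L2 N →L[ℂ] h.H0 N :=
  ((h.inclL2 N).equivRange.symm : (h.inclL2 N).range →L[ℂ] h.H0 N) ∘L
    (h.inclL2 N).range.orthogonalProjectionOnto


theorem inner_proj [FiniteDimensional ℂ (h.H0 N)] (u : h.L2 N) (t : h.H0 N) :
    inner ℂ (h.proj N u) t = inner ℂ u (h.inclL2 N t) := by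
  rw [← (h.inclL2 N).inner_map_map]
  have h1 : h.inclL2 N (h.proj N u) = (h.inclL2 N).range.orthogonalProjectionOnto u := by
    have := (h.inclL2 N).equivRange.apply_symm_apply
      ((h.inclL2 N).range.orthogonalProjectionOnto u)
    exact congrArg Subtype.val this
  rw [h1]
  have h2 := (h.inclL2 N).range.inner_orthogonalProjectionOnto_eq_of_mem_left
    (⟨h.inclL2 N t, t, rfl⟩ : (h.inclL2 N).range) u
  rw [← inner_conj_symm, ← inner_conj_symm u]
  exact congrArg conj h2

/-- Multiplication of sections by a real smooth function. -/
def mulSmooth (f : C^∞⟮𝓘(ℝ, Fin m → ℂ), M; 𝓘(ℝ, ℝ), ℝ⟯) : h.Sec N →ₗ[ℂ] h.Sec N where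
  toFun s := s.mulFun ⟨f, f.contMDiff.continuous⟩
  map_add' s t := Sec.ext fun z => by simp [Sec.val_mulFun, Sec.val_add]
  map_smul' c s := Sec.ext fun z => by
    simp only [Sec.val_mulFun, Sec.val_smul, RingHom.id_apply, smul_smul, mul_comm]

variable (h N) in
/-- The Toeplitz operator `T_{f,N} s = Π_N (f s)` on `V_N`. -/
def toeplitz [FiniteDimensional ℂ (h.H0 N)] (f : C^∞⟮𝓘(ℝ, Fin m → ℂ), M; 𝓘(ℝ, ℝ), ℝ⟯) :
    h.H0 N →ₗ[ℂ] h.H0 N :=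
  (h.proj N).toLinearMap ∘ₗ UniformSpace.Completion.toComplₗᵢ.toLinearMap ∘ₗ mulSmooth f ∘ₗ
    (h.H0 N).subtype

theorem toeplitz_isSymmetric [FiniteDimensional ℂ (h.H0 N)]
    (f : C^∞⟮𝓘(ℝ, Fin m → ℂ), M; 𝓘(ℝ, ℝ), ℝ⟯) : (h.toeplitz N f).IsSymmetric := by
  have key : ∀ s t : h.H0 N, inner ℂ (h.toeplitz N f s) t =
      inner ℂ (mulSmooth f (s : h.Sec N)) (t : h.Sec N) := by
    intro s t
    rw [toeplitz]
    simp only [LinearMap.comp_apply]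
    refine (inner_proj _ t).trans ?_
    exact UniformSpace.Completion.inner_coe _ _
  intro s t
  rw [key, ← inner_conj_symm s, key, inner_conj_symm, inner_def, inner_def]
  congr 1
  funext z
  simp [mulSmooth, Sec.val_mulFun, tensorForm]
  ring

variable (h N) in
/-- The trace-free part `T⁰_{f,N} = T_{f,N} - (tr T_{f,N} / dim V_N) id`. -/
def toeplitz0 [FiniteDimensional ℂ (h.H0 N)] (f : C^∞⟮𝓘(ℝ, Fin m → ℂ), M; 𝓘(ℝ, ℝ), ℝ⟯) :
    h.H0 N →ₗ[ℂ] h.H0 N :=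
  h.toeplitz N f -
    (LinearMap.trace ℂ _ (h.toeplitz N f) / (Module.finrank ℂ (h.H0 N) : ℂ)) • LinearMap.id

variable (h N) in
/-- `i T⁰_{f,N}` as an element of `su(V_N)`. -/
def iToeplitz0 [FiniteDimensional ℂ (h.H0 N)] (f : C^∞⟮𝓘(ℝ, Fin m → ℂ), M; 𝓘(ℝ, ℝ), ℝ⟯) :
    su (h.H0 N) :=
  ⟨Complex.I • h.toeplitz0 N f, by
    have hs := toeplitz_isSymmetric (h := h) (N := N) f
    have htr : conj (LinearMap.trace ℂ _ (h.toeplitz N f)) =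
        LinearMap.trace ℂ _ (h.toeplitz N f) := by
      rw [LinearMap.trace_eq_sum_inner _ (stdOrthonormalBasis ℂ (h.H0 N)), map_sum]
      exact Finset.sum_congr rfl fun i _ => by rw [inner_conj_symm, hs]
    refine ⟨fun u v => ?_, ?_⟩
    · simp only [toeplitz0, LinearMap.smul_apply, LinearMap.sub_apply, LinearMap.id_apply,
        inner_smul_left, inner_smul_right, inner_sub_left, inner_sub_right, hs u v, map_div₀, htr,
        Complex.conj_I, Complex.conj_natCast]
      ring
    · rw [toeplitz0, map_smul, map_sub, map_smul, LinearMap.trace_id]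
      rcases Nat.eq_zero_or_pos (Module.finrank ℂ (h.H0 N)) with h0 | h0
      · have := Module.finrank_zero_iff.1 h0
        have : h.toeplitz N f = 0 := LinearMap.ext fun v => Subsingleton.elim _ _
        simp [this]
      · have : (Module.finrank ℂ (h.H0 N) : ℂ) ≠ 0 := by simpa using h0.ne'
        rw [smul_eq_mul, smul_eq_mul, div_mul_cancel₀ _ this, sub_self, mul_zero]⟩

/-! ### Coherent states and the Szegő kernel -/

variable (h) in
/-- The unit circle bundle `X` of the dual bundle of `L`. -/
structure CircleBundle where
  /-- The base point `π(x)`. -/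
  pt : M
  /-- The unit covector at the base point. -/
  cov : L pt →ₗ[ℂ] ℂ
  isUnit : h.IsUnitCovector cov

variable (h) in
/-- A point of `X` over `z`. -/
def lift (z : M) : h.CircleBundle := ⟨z, h.unitCovector z, h.unitCovector_isUnit z⟩

/-- The function `ŝ(x) = x^{⊗N}(s(π(x)))` on `X` that corresponds to a section `s`. -/
def hat (s : h.Sec N) (x : h.CircleBundle) : ℂ := tpow N x.cov (s.val x.pt)

variable (N) in
/-- The functional `s ↦ ŝ(x)` on `V_N`. -/
def evalAt (x : h.CircleBundle) : Module.Dual ℂ (h.H0 N) where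
  toFun s := hat s.1 x
  map_add' s t := by simp [hat, Sec.val_add]
  map_smul' c s := by simp [hat, Sec.val_smul]

variable (N) in
/-- The coherent state `e_{x,N} ∈ V_N`: `ŝ(x) = ⟨s, e_{x,N}⟩` for all `s ∈ V_N`. -/
def coherent [FiniteDimensional ℂ (h.H0 N)] (x : h.CircleBundle) : h.H0 N := riesz (evalAt N x)

variable (N) in
/-- The kernel `Π_N(x, x')` of the projector `Π_N`, `Π_N(·, x') = ê_{x',N}`;
see `hat_proj` for its characterization as an integral kernel. -/
def szego [FiniteDimensional ℂ (h.H0 N)] (x x' : h.CircleBundle) : ℂ := hat (coherent N x').1 x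

theorem inner_coherent [FiniteDimensional ℂ (h.H0 N)] (x : h.CircleBundle) (s : h.H0 N) :
    inner ℂ (coherent N x) s = hat s.1 x := inner_riesz _ _

theorem szego_eq_inner [FiniteDimensional ℂ (h.H0 N)] (x x' : h.CircleBundle) :
    szego N x x' = inner ℂ (coherent N x) (coherent N x') := (inner_coherent _ _).symm

theorem szego_conj [FiniteDimensional ℂ (h.H0 N)] (x x' : h.CircleBundle) :
    conj (szego N x' x) = szego N x x' := by
  rw [szego_eq_inner, szego_eq_inner, inner_conj_symm]

/-- `szego` is the integral kernel of `Π_N`: `(Π_N s)^(x) = ∫ Π_N(x, x') ŝ(x')`. The integrand is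
constant on the circles of `X`, so the integral over `X` is the integral over `M` of its value at
any point `x'` over `z'`. -/
theorem hat_proj [FiniteDimensional ℂ (h.H0 N)] (s : h.Sec N) (x : h.CircleBundle)
    (σ : M → h.CircleBundle) (hσ : ∀ z, (σ z).pt = z) :
    hat (h.proj N (s : h.L2 N)).1 x = ∫ z', szego N x (σ z') * hat s (σ z') ∂h.dV := by
  rw [← inner_coherent, ← inner_conj_symm, inner_proj, inner_conj_symm]
  refine (UniformSpace.Completion.inner_coe _ _).trans ?_
  rw [inner_def]
  congr 1
  funext z
  rw [← szego_conj]
  have : ∀ y : h.CircleBundle, h.tensorForm N y.pt (s.val y.pt) ((coherent N x).1.val y.pt) =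
      conj (szego N y x) * hat s y := fun y => by
    rw [h.tensorForm_eq N y.isUnit, mul_comm]; rfl
  have h2 := this (σ z)
  rwa [hσ] at h2

variable (h N) in
/-- `K_N(z, z') = |Π_N(x, x')|²` for `x` over `z` and `x'` over `z'`. -/
def K [FiniteDimensional ℂ (h.H0 N)] (z z' : M) : ℝ := ‖szego N (h.lift z) (h.lift z')‖ ^ 2

variable (h N) in
/-- `E_N(z) = Π_N(x, x)` for `x` over `z`. -/
def E [FiniteDimensional ℂ (h.H0 N)] (z : M) : ℝ := (szego N (h.lift z) (h.lift z)).re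

theorem exists_coherent_phase [FiniteDimensional ℂ (h.H0 N)] (x : h.CircleBundle) :
    ∃ c : ℂ, ‖c‖ = 1 ∧ coherent N x = c • coherent N (h.lift x.pt) := by
  obtain ⟨c, hc, hx⟩ := h.exists_phase (h.unitCovector_isUnit x.pt) x.isUnit
  refine ⟨conj (c ^ N), by simp [hc], ?_⟩
  apply ext_inner_right ℂ
  intro s
  rw [inner_smul_left, Complex.conj_conj, inner_coherent, inner_coherent, hat, hx, tpow_smul]
  rfl

theorem K_eq [FiniteDimensional ℂ (h.H0 N)] (x x' : h.CircleBundle) :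
    h.K N x.pt x'.pt = ‖szego N x x'‖ ^ 2 := by
  obtain ⟨c, hc, hx⟩ := exists_coherent_phase (N := N) x
  obtain ⟨c', hc', hx'⟩ := exists_coherent_phase (N := N) x'
  rw [K, szego_eq_inner, szego_eq_inner, hx, hx', inner_smul_left, inner_smul_right]
  simp [hc, hc']

theorem E_eq [FiniteDimensional ℂ (h.H0 N)] (x : h.CircleBundle) :
    (h.E N x.pt : ℂ) = szego N x x := by
  obtain ⟨c, hc, hx⟩ := exists_coherent_phase (N := N) x
  rw [E, szego_eq_inner, szego_eq_inner, hx, inner_self_eq_norm_sq_to_K,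
    inner_self_eq_norm_sq_to_K, norm_smul, hc, one_mul]
  simp [← Complex.ofReal_pow]

/-! ### The operator `P⁰_N` -/

variable (h N) in
/-- The point `z` is not a base point of the linear system of `L^N`. -/
def NotBasePoint (z : M) : Prop := ∃ s : h.H0 N, s.1.val z ≠ 0

theorem NotBasePoint.evalAt_ne_zero {z : M} (hz : h.NotBasePoint N z) :
    evalAt N (h.lift z) ≠ 0 := by
  obtain ⟨s, hs⟩ := hz
  intro h0
  exact hs ((tpow_eq_zero_iff (h.unitCovector_isUnit z) _).1 (LinearMap.congr_fun h0 s))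

variable (h N) in
/-- The map `φ_N` to `ℙ(V_N^*)` of the complete linear system of `L^N`, `φ_N(z) = [s ↦ s(z)]`,
where the fibre of `L^N` at `z` is identified with `ℂ` by any non-zero covector; it is defined
outside the base points. -/
def phi (z : M) (hz : h.NotBasePoint N z) : ℙ ℂ (Module.Dual ℂ (h.H0 N)) :=
  Projectivization.mk ℂ (evalAt N (h.lift z)) hz.evalAt_ne_zero

variable (h N) in
/-- `P⁰_N f(z) = (Φ_N(φ_N(z)), i T⁰_{f,N})`. -/
def P0 [FiniteDimensional ℂ (h.H0 N)] (f : C^∞⟮𝓘(ℝ, Fin m → ℂ), M; 𝓘(ℝ, ℝ), ℝ⟯) (z : M)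
    (hz : h.NotBasePoint N z) : ℂ :=
  killing (momentMap (h.phi N z hz)) (h.iToeplitz0 N f)

end PositiveMetric

end Volume

end Geometry

end Toeplitz

end

/-! The theorem rests on the reproducing property of the coherent state `e_x`. Evaluation at `z` is
`⟨·, e_x⟩` for `x` over `z`, so `Φ_N(φ_N(z))` is `i` times the trace-free part of the orthogonal
projector onto the line of `e_x`. Pairing it with `iA`, where `A` is trace-free, gives the
expectation `⟨A e_x, e_x⟩ / |e_x|²` (`killing_momentMap_mk`). For `A = T⁰_{f,N}` this is the
expectation of `T_{f,N}` minus its mean eigenvalue.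

For `s` in `V_N` the projector disappears from `⟨Π_N(fs), s⟩`, which leaves `∫ |ŝ|² f`
(`inner_toeplitz_self`). With `s = e_x` one has `|ê_x(x')|² = K_N(z, z')` and `|e_x|² = E_N(z)`,
which is part 1. Summing over an orthonormal basis `s_i` and using Parseval, `∑ |ŝ_i(x)|² = |e_x|² =
E_N(z)`, gives part 2.

All of this requires `V_N` to be finite-dimensional, which is proved by compactness. By the Schwarz
lemma a section vanishing at `p` is at most half its maximum on a neighbourhood of `p` that does not
depend on the section. Finitely many such neighbourhoods cover `M`, so a section vanishing at their
centres has a maximum at most half of itself, and is zero. Evaluation at the centres therefore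
embeds `V_N` in a finite power of `ℂ`. -/

namespace Toeplitz

namespace PositiveMetric

open Filter Topology

variable {m : ℕ} {M : Type*} [TopologicalSpace M] [ChartedSpace (Fin m → ℂ) M]
  {L : M → Type*} [TopologicalSpace (TotalSpace ℂ L)] [∀ z, AddCommGroup (L z)]
  [∀ z, Module ℂ (L z)] [∀ z, TopologicalSpace (L z)] [FiberBundle ℂ L] [VectorBundle ℂ ℂ L]
  [CompactSpace M] [T2Space M] [MeasurableSpace M] [BorelSpace M]
  {h : PositiveMetric m L} {N : ℕ}

/-! ### Finite dimension of the space of holomorphic sections -/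

/-- The normalized covector of `e` and the one chosen in `lift` differ by a phase. This is the
bridge between the global pointwise norm of `s` and its coordinate, to which complex analysis
applies. -/
theorem norm_hat_lift (s : h.Sec N) (e : Triv L) [MemTrivializationAtlas e] {z : M}
    (hz : z ∈ e.baseSet) : ‖hat s (h.lift z)‖ =
      Real.sqrt (h.form z (e.symm z 1) (e.symm z 1)).re ^ N * ‖coord L N e s.val z‖ := by
  obtain ⟨c, hc, hx⟩ := h.exists_phase (h.smul_isUnitCovector e hz) (h.unitCovector_isUnit z)
  change ‖tpow N (h.unitCovector z) (s.val z)‖ = _ * ‖tpow N (e.linearMapAt ℂ z) (s.val z)‖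
  rw [hx, tpow_smul, tpow_smul, LinearMap.smul_apply, LinearMap.smul_apply, norm_smul, norm_smul,
    norm_pow, norm_pow, hc, one_pow, one_mul, Complex.norm_real,
    Real.norm_of_nonneg (Real.sqrt_nonneg _)]

theorem tensorForm_self_eq_norm_hat (s : h.Sec N) (z : M) :
    h.tensorForm N z (s.val z) (s.val z) = ((‖hat s (h.lift z)‖ ^ 2 : ℝ) : ℂ) :=
  tensorForm_self z _

/-- The lift is chosen point by point and need not be continuous; continuity comes from `h^{⊗N}(s,
s)`, which does not see the phase. -/
theorem continuous_norm_hat_sq (s : h.Sec N) :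
    Continuous fun z => ‖hat s (h.lift z)‖ ^ 2 := by
  refine (Complex.continuous_re.comp (continuous_tensorForm h s s)).congr fun z => ?_
  exact congrArg Complex.re (tensorForm_self_eq_norm_hat s z)

theorem continuous_norm_hat (s : h.Sec N) : Continuous fun z => ‖hat s (h.lift z)‖ := by
  refine (continuous_norm_hat_sq s).sqrt.congr fun z => ?_
  rw [Real.sqrt_sq (norm_nonneg _)]

theorem hat_lift_eq_zero_iff (s : h.Sec N) (z : M) : hat s (h.lift z) = 0 ↔ s.val z = 0 :=
  tpow_eq_zero_iff (h.unitCovector_isUnit z) _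

theorem differentiableOn_coord_chart [IsManifold 𝓘(ℂ, Fin m → ℂ) ω M] (s : h.H0 N) (e : Triv L)
    [MemTrivializationAtlas e] {φ : OpenPartialHomeomorph M (Fin m → ℂ)}
    (hφ : φ ∈ atlas (Fin m → ℂ) M) :
    DifferentiableOn ℂ (fun w => coord L N e s.1.val (φ.symm w)) (overlap e φ) := by
  have : IsManifold 𝓘(ℂ, Fin m → ℂ) 1 M := IsManifold.of_le (n := ω) le_top
  rw [← mdifferentiableOn_iff_differentiableOn]
  exact (s.2 e).comp ((mdifferentiableOn_atlas_symm hφ).mono inter_subset_left)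
    fun w hw => hw.2

/-- By the Schwarz lemma, a holomorphic section that vanishes at `p` is small near `p`, uniformly
in terms of its maximum. -/
theorem eventually_norm_hat_le_half [IsManifold 𝓘(ℂ, Fin m → ℂ) ω M] (h : PositiveMetric m L)
    (N : ℕ) (p : M) :
    ∀ᶠ z in 𝓝 p, ∀ s : h.H0 N, s.1.val p = 0 → ∀ S : ℝ, (∀ y, ‖hat s.1 (h.lift y)‖ ≤ S) →
      ‖hat s.1 (h.lift z)‖ ≤ S / 2 := by
  set φ := chartAt (Fin m → ℂ) p with hφ
  set e := trivializationAt ℂ L p with he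
  have hps : p ∈ φ.source := mem_chart_source _ p
  have hpe : p ∈ e.baseSet := FiberBundle.mem_baseSet_trivializationAt' p
  -- `b` is the length of the induced frame of `L^N`, so the pointwise norm of a section is `b`
  -- times the modulus of its coordinate.
  set b : M → ℝ := fun y => Real.sqrt (h.form y (e.symm y 1) (e.symm y 1)).re ^ N with hb
  have hbc : ContinuousAt b p :=
    ((continuousOn_weight h e).sqrt.pow N).continuousAt (e.open_baseSet.mem_nhds hpe)
  have hbp : 0 < b p := pow_pos (Real.sqrt_pos.2 (h.pos_def _ _ (frame_ne_zero e hpe))) N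
  have hlow : ∀ᶠ y in 𝓝 p, b p / 2 < b y := hbc.eventually (lt_mem_nhds (half_lt_self hbp))
  have hupp : ∀ᶠ y in 𝓝 p, b y < 2 * b p := hbc.eventually (gt_mem_nhds (by linarith))
  have hev : ∀ᶠ y in 𝓝 p, y ∈ e.baseSet ∧ b p / 2 < b y ∧ b y < 2 * b p :=
    (e.open_baseSet.eventually_mem hpe).and (hlow.and hupp)
  have hsymm : Tendsto φ.symm (𝓝 (φ p)) (𝓝 p) := by
    have := φ.continuousAt_symm (φ.map_source hps)
    rwa [ContinuousAt, φ.left_inv hps] at this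
  -- The radius is fixed before any section is introduced, which makes the final neighbourhood
  -- uniform in `s`.
  obtain ⟨r, hr, hball⟩ := Metric.eventually_nhds_iff_ball.1
    ((φ.open_target.eventually_mem (φ.map_source hps)).and (hsymm.eventually hev))
  -- Passing from norms to coordinates and back costs a factor `2 b(p) / (b(p) / 2) = 4`, so
  -- shrinking the radius by `8` leaves `1/2`.
  have hnear : ∀ᶠ z in 𝓝 p, dist (φ z) (φ p) < r / 8 :=
    (φ.continuousAt hps).eventually (Metric.ball_mem_nhds _ (by positivity))
  filter_upwards [hnear, φ.open_source.mem_nhds hps] with z hz hzs s hs S hS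
  have hS0 : 0 ≤ S := (norm_nonneg _).trans (hS p)
  set g : (Fin m → ℂ) → ℂ := fun w => coord L N e s.1.val (φ.symm w) with hg
  have hgp : g (φ p) = 0 := by
    change coord L N e s.1.val (φ.symm (φ p)) = 0
    rw [φ.left_inv hps, coord, hs, map_zero]
  have hd : DifferentiableOn ℂ g (Metric.ball (φ p) r) :=
    (differentiableOn_coord_chart s e (chart_mem_atlas _ p)).mono fun w hw =>
      ⟨(hball w hw).1, (hball w hw).2.1⟩
  -- The lower bound on `b` turns `|s| ≤ S` into a bound on the coordinate. With a closed ball as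
  -- target, `S = 0` needs no separate case.
  have hmaps : MapsTo g (Metric.ball (φ p) r) (Metric.closedBall (g (φ p)) (S / (b p / 2))) := by
    intro w hw
    obtain ⟨-, hwe, hwl, -⟩ := hball w hw
    rw [hgp, mem_closedBall_zero_iff, le_div_iff₀ (by positivity)]
    calc ‖g w‖ * (b p / 2) ≤ b (φ.symm w) * ‖g w‖ := by rw [mul_comm]; gcongr
      _ = ‖hat s.1 (h.lift (φ.symm w))‖ := (norm_hat_lift s.1 e hwe).symm
      _ ≤ S := hS _
  have hzb : φ z ∈ Metric.ball (φ p) r := Metric.mem_ball.2 (hz.trans (by linarith))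
  have hsch := Complex.dist_le_div_mul_dist_of_mapsTo_ball hd hmaps hzb
  obtain ⟨-, hze, -, hzu⟩ := hball _ hzb
  have hgz : g (φ z) = coord L N e s.1.val z := by simp only [hg, φ.left_inv hzs]
  rw [φ.left_inv hzs] at hze hzu
  rw [hgp, dist_zero_right, hgz] at hsch
  calc ‖hat s.1 (h.lift z)‖ = b z * ‖coord L N e s.1.val z‖ := norm_hat_lift s.1 e hze
    _ ≤ (2 * b p) * (S / (b p / 2) / r * (r / 8)) := by gcongr; exact hsch.trans (by gcongr)
    _ = S / 2 := by field_simp; ring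

/-- The maximum of the norm is attained in one of finitely many neighbourhoods on which it is at
most half of itself. -/
theorem exists_finset_eq_zero_of_forall [IsManifold 𝓘(ℂ, Fin m → ℂ) ω M]
    (h : PositiveMetric m L) (N : ℕ) :
    ∃ F : Finset M, ∀ s : h.H0 N, (∀ p ∈ F, s.1.val p = 0) → s = 0 := by
  obtain ⟨F, -, hF⟩ := isCompact_univ.elim_nhds_subcover _
    fun p _ => eventually_norm_hat_le_half h N p
  refine ⟨F, fun s hs => Subtype.ext (Sec.ext fun z => ?_)⟩
  have : Nonempty M := ⟨z⟩
  obtain ⟨q, hq⟩ := (continuous_norm_hat s.1).exists_forall_ge_of_hasCompactSupport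
    (HasCompactSupport.of_compactSpace _)
  obtain ⟨p, hp, hqp⟩ := mem_iUnion₂.1 (hF (mem_univ q))
  -- Here `S` is the maximum itself, the norm of `s` at `q`.
  have h1 := hqp s (hs p hp) _ hq
  have h2 : ‖hat s.1 (h.lift z)‖ ≤ 0 := (hq z).trans (by linarith)
  exact (hat_lift_eq_zero_iff s.1 z).1 (norm_le_zero_iff.1 h2)

theorem finiteDimensional_H0 [IsManifold 𝓘(ℂ, Fin m → ℂ) ω M] (h : PositiveMetric m L) (N : ℕ) :
    FiniteDimensional ℂ (h.H0 N) := by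
  obtain ⟨F, hF⟩ := exists_finset_eq_zero_of_forall h N
  let ev : h.H0 N →ₗ[ℂ] (F → ℂ) := LinearMap.pi fun p => evalAt N (h.lift p)
  refine FiniteDimensional.of_injective ev ((injective_iff_map_eq_zero ev).2 fun s hs => ?_)
  exact hF s fun p hp => (hat_lift_eq_zero_iff s.1 p).1 (congrFun hs ⟨p, hp⟩)

/-! ### Quadratic form and trace of a Toeplitz operator -/

theorem integrable_norm_hat_sq_mul (f : C^∞⟮𝓘(ℝ, Fin m → ℂ), M; 𝓘(ℝ, ℝ), ℝ⟯)
    (s : h.Sec N) :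
    Integrable (fun z => ‖hat s (h.lift z)‖ ^ 2 * f z) h.dV :=
  ((continuous_norm_hat_sq s).mul f.contMDiff.continuous).integrable_of_hasCompactSupport
    (HasCompactSupport.of_compactSpace _)

section Trace

variable [FiniteDimensional ℂ (h.H0 N)]

theorem E_eq_norm_coherent_sq (z : M) : h.E N z = ‖coherent N (h.lift z)‖ ^ 2 := by
  rw [E, szego_eq_inner, inner_self_eq_norm_sq_to_K]
  simp [← Complex.ofReal_pow]

theorem E_pos {z : M} (hz : h.NotBasePoint N z) : 0 < h.E N z := by
  rw [E_eq_norm_coherent_sq]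
  exact pow_pos (norm_pos_iff.2 (riesz_ne_zero hz.evalAt_ne_zero)) 2

/-- Parseval for the coherent state, whose coefficients in the basis are, up to conjugation, the
values of the basis sections at `x`. -/
theorem E_eq_sum_norm_hat_sq {ι : Type*} [Fintype ι] (b : OrthonormalBasis ι ℂ (h.H0 N)) (z : M) :
    h.E N z = ∑ i, ‖hat (b i).1 (h.lift z)‖ ^ 2 := by
  rw [E_eq_norm_coherent_sq, ← b.sum_sq_norm_inner_left]
  simp only [inner_coherent]

/-- Hermitian symmetry of the kernel swaps the two points, so that for fixed `z` the kernel is the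
squared norm of a single section in the variable `z'`. -/
theorem K_eq_norm_hat_sq (z z' : M) :
    h.K N z z' = ‖hat (coherent N (h.lift z)).1 (h.lift z')‖ ^ 2 := by
  rw [K, ← szego_conj, RCLike.norm_conj, szego]

variable (f : C^∞⟮𝓘(ℝ, Fin m → ℂ), M; 𝓘(ℝ, ℝ), ℝ⟯)

/-- The projector is self-adjoint and fixes `s`, so only multiplication by `f` remains. -/
theorem inner_toeplitz_self (s : h.H0 N) :
    inner ℂ s (h.toeplitz N f s) =
      ((∫ z, ‖hat s.1 (h.lift z)‖ ^ 2 * f z ∂h.dV : ℝ) : ℂ) := by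
  have key : inner ℂ (h.toeplitz N f s) s = inner ℂ (mulSmooth f (s : h.Sec N)) (s : h.Sec N) := by
    rw [toeplitz]
    simp only [LinearMap.comp_apply]
    exact (inner_proj _ s).trans (UniformSpace.Completion.inner_coe _ _)
  -- `f s` now sits in the conjugate-linear slot; `f` comes out unchanged because it is real.
  rw [← toeplitz_isSymmetric, key, inner_def, ← integral_complex_ofReal]
  congr 1
  funext z
  have h1 := tensorForm_self_eq_norm_hat s.1 z
  have h2 : h.tensorForm N z (s.1.val z) ((mulSmooth f s.1).val z) =
      h.tensorForm N z (s.1.val z) (s.1.val z) * f z := by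
    simp [mulSmooth, Sec.val_mulFun, tensorForm]
    ring
  rw [h2, h1, Complex.ofReal_mul]

/-- At a base point `E_N(z) = 0`, and the quotient is `0` by the convention for division, so `z` may
be arbitrary. -/
theorem integrable_K_div_E_mul (z : M) :
    Integrable (fun z' => h.K N z z' / h.E N z * f z') h.dV := by
  refine ((integrable_norm_hat_sq_mul f (coherent N (h.lift z)).1).const_mul
    (h.E N z)⁻¹).congr (Eventually.of_forall fun z' => ?_)
  simp only [K_eq_norm_hat_sq]
  ring

theorem integrable_E_mul : Integrable (fun z => h.E N z * f z) h.dV := by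
  simp only [E_eq_sum_norm_hat_sq (stdOrthonormalBasis ℂ (h.H0 N)), Finset.sum_mul]
  exact integrable_finsetSum _ fun i _ => integrable_norm_hat_sq_mul f _

/-- The diagonal entries in an orthonormal basis are the integrals `∫ |ŝ_i|² f`, and Parseval under
the integral sums them to `∫ E_N f`. -/
theorem trace_toeplitz :
    LinearMap.trace ℂ _ (h.toeplitz N f) = ((∫ z, h.E N z * f z ∂h.dV : ℝ) : ℂ) := by
  simp only [E_eq_sum_norm_hat_sq (stdOrthonormalBasis ℂ (h.H0 N)), Finset.sum_mul]
  rw [integral_finsetSum _ fun i _ => integrable_norm_hat_sq_mul f _, Complex.ofReal_sum,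
    LinearMap.trace_eq_sum_inner _ (stdOrthonormalBasis ℂ (h.H0 N))]
  exact Finset.sum_congr rfl fun i _ => inner_toeplitz_self f _

end Trace

end PositiveMetric

/-! ### Pairing with the moment map -/

/-- Pairing `i A ∈ su(W)` with a value of the moment map gives the expectation of `A`. -/
theorem killing_momentMap_mk {W : Type*} [NormedAddCommGroup W] [InnerProductSpace ℂ W]
    [FiniteDimensional ℂ W] (ξ : Module.Dual ℂ W) (hξ : ξ ≠ 0) (X : su W) (A : W →ₗ[ℂ] W)
    (hX : X.1 = Complex.I • A) :
    killing (momentMap (Projectivization.mk ℂ ξ hξ)) X =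
      ((‖riesz ξ‖ ^ 2 : ℝ) : ℂ)⁻¹ * inner ℂ (riesz ξ) (A (riesz ξ)) := by
  -- Membership of `iA` in `su(W)` supplies this; it removes the `id / dim W` term of the moment
  -- map.
  have hA : LinearMap.trace ℂ W A = 0 := by
    have := X.2.2
    rw [hX, map_smul, smul_eq_mul] at this
    exact (mul_eq_zero.1 this).resolve_left Complex.I_ne_zero
  set w := riesz ξ
  -- The sign comes from `i · i = -1` and cancels the one in `-tr`. The rank-one term `v ↦ ⟨Av, w⟩
  -- w` has trace `⟨Aw, w⟩`.
  have hcomp : momentEnd w ∘ₗ (Complex.I • A) =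
      -(((‖w‖ ^ 2 : ℝ) : ℂ)⁻¹ • ((innerₛₗ ℂ w ∘ₗ A).smulRight w) -
        (Module.finrank ℂ W : ℂ)⁻¹ • A) := by
    ext v
    simp only [momentEnd, LinearMap.comp_apply, LinearMap.smul_apply, LinearMap.sub_apply,
      LinearMap.neg_apply, LinearMap.smulRight_apply, innerₛₗ_apply_apply, LinearMap.id_apply,
      inner_smul_right]
    rw [← neg_one_smul ℂ, ← Complex.I_mul_I]
    module
  rw [killing, momentMap_mk, hX, hcomp, map_neg, neg_neg, map_sub, map_smul, map_smul, hA,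
    LinearMap.trace_smulRight]
  simp

/-! ### The formula for `P⁰_N` and the main theorem -/

namespace PositiveMetric

variable {m : ℕ} {M : Type*} [TopologicalSpace M] [ChartedSpace (Fin m → ℂ) M]
  {L : M → Type*} [TopologicalSpace (TotalSpace ℂ L)] [∀ z, AddCommGroup (L z)]
  [∀ z, Module ℂ (L z)] [∀ z, TopologicalSpace (L z)] [FiberBundle ℂ L] [VectorBundle ℂ ℂ L]
  [CompactSpace M] [T2Space M] [MeasurableSpace M] [BorelSpace M]
  {h : PositiveMetric m L} {N : ℕ}

theorem P0_eq [FiniteDimensional ℂ (h.H0 N)] (f : C^∞⟮𝓘(ℝ, Fin m → ℂ), M; 𝓘(ℝ, ℝ), ℝ⟯) (z : M)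
    (hz : h.NotBasePoint N z) :
    h.P0 N f z hz = ((∫ z', h.K N z z' / h.E N z * f z' ∂h.dV : ℝ) : ℂ) -
      LinearMap.trace ℂ _ (h.toeplitz N f) / (Module.finrank ℂ (h.H0 N) : ℂ) := by
  have hE : (h.E N z : ℂ) ≠ 0 := Complex.ofReal_ne_zero.2 (E_pos hz).ne'
  have hint : ∫ z', h.K N z z' / h.E N z * f z' ∂h.dV =
      (h.E N z)⁻¹ * ∫ z', ‖hat (coherent N (h.lift z)).1 (h.lift z')‖ ^ 2 * f z' ∂h.dV := by
    rw [← integral_const_mul]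
    congr 1
    funext z'
    rw [K_eq_norm_hat_sq]
    ring
  rw [P0, phi, killing_momentMap_mk _ _ _ (h.toeplitz0 N f) rfl]
  -- The Riesz vector of the evaluation functional is the coherent state by definition.
  change ((‖coherent N (h.lift z)‖ ^ 2 : ℝ) : ℂ)⁻¹ *
    inner ℂ (coherent N (h.lift z)) (h.toeplitz0 N f (coherent N (h.lift z))) = _
  rw [toeplitz0, LinearMap.sub_apply, LinearMap.smul_apply, LinearMap.id_apply, inner_sub_right,
    inner_smul_right, inner_toeplitz_self, inner_self_eq_norm_sq_to_K, hint,
    ← E_eq_norm_coherent_sq, Complex.ofReal_mul, Complex.ofReal_inv]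
  -- In the scalar part of `T⁰_{f,N}` the factor `|e_x|² = E_N(z)` cancels the normalization,
  -- leaving the mean eigenvalue.
  have hn : ((‖coherent N (h.lift z)‖ : ℝ) : ℂ) ^ 2 = (h.E N z : ℂ) := by
    rw [E_eq_norm_coherent_sq, Complex.ofReal_pow]
  rw [mul_sub]
  congr 1
  refine Eq.trans (congrArg _ (congrArg _ hn)) ?_
  field_simp

end PositiveMetric

end Toeplitz

/-- Finite dimension is asserted first because the projector, the coherent states and the kernels
are defined relative to it. The integrability claims ensure that neither integral is the default
value `0` of a non-integrable function. -/
theorem theorem2 {m : ℕ} {M : Type*} [TopologicalSpace M] [CompactSpace M] [T2Space M]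
    [ChartedSpace (Fin m → ℂ) M] [IsManifold 𝓘(ℂ, Fin m → ℂ) ω M]
    [MeasurableSpace M] [BorelSpace M]
    {L : M → Type*} [TopologicalSpace (TotalSpace ℂ L)] [∀ z, AddCommGroup (L z)]
    [∀ z, Module ℂ (L z)] [∀ z, TopologicalSpace (L z)] [FiberBundle ℂ L] [VectorBundle ℂ ℂ L]
    [ContMDiffVectorBundle ω ℂ L 𝓘(ℂ, Fin m → ℂ)]
    (h : Toeplitz.PositiveMetric m L) (N : ℕ)
    (f : C^∞⟮𝓘(ℝ, Fin m → ℂ), M; 𝓘(ℝ, ℝ), ℝ⟯) :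
    ∃ _ : FiniteDimensional ℂ (h.H0 N),
      (∀ (z : M) (hz : h.NotBasePoint N z),
        0 < h.E N z ∧
        Integrable (fun z' => h.K N z z' / h.E N z * f z') h.dV ∧
        h.P0 N f z hz = ((∫ z', h.K N z z' / h.E N z * f z' ∂h.dV : ℝ) : ℂ) -
          LinearMap.trace ℂ _ (h.toeplitz N f) / (Module.finrank ℂ (h.H0 N) : ℂ)) ∧
      Integrable (fun z => h.E N z * f z) h.dV ∧
      LinearMap.trace ℂ _ (h.toeplitz N f) = ((∫ z, h.E N z * f z ∂h.dV : ℝ) : ℂ) := by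
  have := h.finiteDimensional_H0 N
  exact ⟨this, fun z hz => ⟨Toeplitz.PositiveMetric.E_pos hz,
    Toeplitz.PositiveMetric.integrable_K_div_E_mul f z, Toeplitz.PositiveMetric.P0_eq f z hz⟩,
    Toeplitz.PositiveMetric.integrable_E_mul f, Toeplitz.PositiveMetric.trace_toeplitz f⟩
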